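/- Let $X\subseteq\mathbb P^n$ be a real projective variety (the set of common complex zeros of a family of real forms), $I_X\subset S=\mathbb R[x_0,\dots,x_n]$ its vanishing ideal, $R=S/I_X$ its homogeneous coordinate ring and $R_d$ the degree-$d$ part of $R$. Fix an inner product $\langle\cdot,\cdot\rangle$ on $R_2$ with norm $\|\cdot\|$. Let $\Sigma_X\subseteq R_2$ be the cone of finite sums of squares of elements of $R_1$, and $\Sigma_X^*=\{g\in R_2:\langle g,q\rangle\ge 0\ \text{for all } q\in\Sigma_X\}$. For $k\ge 0$ and $\mathbf h=(h_1,\dots,h_k)\in R_1^k$ put $\sigma_k(\mathbf h)=\sum_i h_i^2$ and $\langle\mathbf h\rangle_2=\{\sum_i h_ip_i: p_1,\dots,p_k\in R_1\}$. Fix $\mathbf l=(l_1,\dots,l_k)\in R_1^k$, let $\langle\mathbf l\rangle\subseteq R$ be the ideal generated by $l_1,\dots,l_k$, and let $\mathrm{Syz}_1(\mathbf l)=\{\mathbf h\in R_1^k:\sum_i l_ih_i=0\}$. For a target $\bar f\in R_2$ consider $\Phi_{\bar f}(\mathbf h)=\|\sigma_k(\mathbf h)-\bar f\|^2$ on $R_1^k$.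 The tuple $\mathbf l$ is a second-order stationary point for $\bar f$ if the gradient of $\Phi_{\bar f}$ vanishes and its Hessian is positive semidefinite at $\mathbf l$. A second-order stationary point, or a local minimum, of $\Phi_{\bar f}$ is called spurious if it is not a global minimum of $\Phi_{\bar f}$ on $R_1^k$. Consider the conditions (i) there is $\bar f\in R_2$ for which $\mathbf l$ is a spurious second-order stationary point; (ii) there is $g\in R_2$ with $g\perp\langle\mathbf l\rangle_2$ and $g\notin\Sigma_X^*$ such that for all $\mathbf h\in\mathrm{Syz}_1(\mathbf l)$ one has $\langle g,\sigma_k(\mathbf h)\rangle\ge 0$, where equality holds only if $g\perp\langle\mathbf h\rangle_2$; (iii) there is $\bar f\in R_2$ for which $\mathbf l$ is a spurious local minimum. If every element of $\Sigma_X$ is a sum of $k$ squares of elements of $R_1$ (that is, $k$ is at least the Pythagoras number of $X$), then (i) and (ii) are equivalent; if moreover $\langle\mathbf l\rangle$ is real radical (a finite sum $\sum_j a_j^2$ with $a_j\in R$ lies in $\langle\mathbf l\rangle$ only if all $a_j$ do), then both are equivalent to (iii). For arbitrary $k$, (iii) implies (i) and (i) implies (ii). Moreover, for arbitrary $k$,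 condition (ii) is equivalent to the existence of $\bar f\in R_2$ such that $\mathbf l$ is a second-order stationary point for $\bar f$ and $\sigma_k(\mathbf l)$ does not minimize $\|q-\bar f\|^2$ over $q\in\Sigma_X$; and if $\langle\mathbf l\rangle$ is real radical, (ii) is also equivalent to the existence of $\bar f\in R_2$ such that $\mathbf l$ is a local minimum of $\Phi_{\bar f}$ and $\sigma_k(\mathbf l)$ does not minimize $\|q-\bar f\|^2$ over $q\in\Sigma_X$. -/

import Mathlib

open scoped LinearAlgebra.Projectivization

noncomputable section

/-- A real subvariety of complex projective `n`-space: the set of complex points at which all members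
of some family of real homogeneous polynomials vanish. (Irreducibility is not required.) -/
structure RealProjectiveVariety (n : ℕ) where
  carrier : Set (ℙ ℂ (Fin (n + 1) → ℂ))
  exists_equations : ∃ F : Set (MvPolynomial (Fin (n + 1)) ℝ),
    (∀ f ∈ F, ∃ d : ℕ, f.IsHomogeneous d) ∧
    carrier = {p | ∀ f ∈ F, MvPolynomial.aeval p.rep f = 0}

/-- An ideal is real radical if a finite sum of squares lies in it only when all the squared
elements lie in it. -/
def IsRealRadical {A : Type*} [CommRing A] (J : Ideal A) : Prop :=
  ∀ (m : ℕ) (a : Fin m → A), ∑ i, a i ^ 2 ∈ J → ∀ i, a i ∈ J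

namespace RealProjectiveVariety

variable {n : ℕ} (X : RealProjectiveVariety n)

/-- The vanishing ideal `I_X` in `ℝ[x_0, …, x_n]`: the polynomials vanishing at every
representative of every point of `X`. It is homogeneous and saturated. -/
def vanishingIdeal : Ideal (MvPolynomial (Fin (n + 1)) ℝ) :=
  MvPolynomial.vanishingIdeal ℝ
    {v : Fin (n + 1) → ℂ | ∃ hv : v ≠ 0, Projectivization.mk ℂ v hv ∈ X.carrier}

/-- The homogeneous coordinate ring `R = ℝ[x_0, …, x_n] / I_X`. -/
def CoordRing : Type := MvPolynomial (Fin (n + 1)) ℝ ⧸ X.vanishingIdeal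

instance : CommRing X.CoordRing :=
  inferInstanceAs (CommRing (MvPolynomial (Fin (n + 1)) ℝ ⧸ X.vanishingIdeal))

instance : Algebra ℝ X.CoordRing :=
  inferInstanceAs (Algebra ℝ (MvPolynomial (Fin (n + 1)) ℝ ⧸ X.vanishingIdeal))

/-- The quotient map `ℝ[x_0, …, x_n] → R`. -/
def toCoordRing : MvPolynomial (Fin (n + 1)) ℝ →ₐ[ℝ] X.CoordRing :=
  Ideal.Quotient.mkₐ ℝ X.vanishingIdeal

/-- The degree `d` part `R_d` of the coordinate ring. -/
def forms (d : ℕ) : Submodule ℝ X.CoordRing :=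
  (MvPolynomial.homogeneousSubmodule (Fin (n + 1)) ℝ d).map
    X.toCoordRing.toLinearMap

theorem mul_mem_forms_two {x y : X.CoordRing} (hx : x ∈ X.forms 1) (hy : y ∈ X.forms 1) :
    x * y ∈ X.forms 2 := by
  obtain ⟨p, hp, rfl⟩ := hx
  obtain ⟨q, hq, rfl⟩ := hy
  exact ⟨p * q, MvPolynomial.IsHomogeneous.mul hp hq,
    map_mul X.toCoordRing p q⟩

variable {X} in
/-- The multiplication `R_1 × R_1 → R_2`. -/
def mulForms (x y : X.forms 1) : X.forms 2 :=
  ⟨(x : X.CoordRing) * (y : X.CoordRing), X.mul_mem_forms_two x.2 y.2⟩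

variable {X} {k : ℕ}

/-- The sum-of-squares map `σ_k : R_1^k → R_2`. -/
def sumSq (l : Fin k → X.forms 1) : X.forms 2 := ∑ i, mulForms (l i) (l i)

/-- The ideal `⟨l⟩` of `R` generated by the entries of `l`. -/
def idealOf (l : Fin k → X.forms 1) : Ideal X.CoordRing :=
  Ideal.span (Set.range fun i => (l i : X.CoordRing))

/-- The quadratic part `⟨l⟩_2 = {∑ l_i h_i : h ∈ R_1^k}` of the ideal generated by `l`. -/
def quadPart (l : Fin k → X.forms 1) : Set (X.forms 2) :=
  {q | ∃ h : Fin k → X.forms 1, q = ∑ i, mulForms (l i) (h i)}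

/-- The linear syzygies `Syz_1(l) = {h ∈ R_1^k : ∑ l_i h_i = 0}`. -/
def linSyz (l : Fin k → X.forms 1) : Set (Fin k → X.forms 1) :=
  {h | ∑ i, mulForms (l i) (h i) = 0}

variable (X) in
/-- The cone `Σ_X` of sums of (any number of) squares of linear forms. -/
def sosCone : Set (X.forms 2) :=
  {g | ∃ (m : ℕ) (a : Fin m → X.forms 1), g = sumSq a}

variable (X) in
/-- Every element of `Σ_X` is a sum of `k` squares, i.e. `k` is at least the Pythagoras number. -/
def PythagorasLE (k : ℕ) : Prop :=
  ∀ g ∈ X.sosCone, ∃ a : Fin k → X.forms 1, g = sumSq a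

section Optimization

variable [ip : InnerProductSpace.Core ℝ (X.forms 2)]

/-- The fixed inner product on `R_2`. -/
def pairing (g q : X.forms 2) : ℝ := ip.toInner.inner g q

variable (X) in
/-- The dual cone `Σ_X^*`, as a subset of `R_2` through the inner product. -/
def sosDual : Set (X.forms 2) := {g | ∀ q ∈ X.sosCone, 0 ≤ pairing g q}

/-- `g` is orthogonal to every element of `S`. -/
def IsOrthTo (g : X.forms 2) (S : Set (X.forms 2)) : Prop := ∀ q ∈ S, pairing g q = 0

/-- The squared distance `‖q - f‖²` to the target `f`. -/
def sqDist (f q : X.forms 2) : ℝ := pairing (q - f) (q - f)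

/-- The objective `l ↦ ‖σ_k(l) - f‖²` of the rank-`k` problem with target `f`. -/
def objective (f : X.forms 2) (l : Fin k → X.forms 1) : ℝ := sqDist f (sumSq l)

/-- `l` is a global minimum of the rank-`k` problem with target `f`. -/
def IsGlobalMin (f : X.forms 2) (l : Fin k → X.forms 1) : Prop :=
  ∀ l' : Fin k → X.forms 1, objective f l ≤ objective f l'

/-- `σ_k(l)` is the minimizer over the whole cone `Σ_X` of the squared distance to `f`. -/
def IsConvexMin (f : X.forms 2) (l : Fin k → X.forms 1) : Prop :=
  ∀ g ∈ X.sosCone, objective f l ≤ sqDist f g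

/-- `l` is a local minimum of the rank-`k` problem with target `f`, for the usual topology of the
finite-dimensional real vector space `R_1^k`. -/
def IsLocalMinimum (f : X.forms 2) (l : Fin k → X.forms 1) : Prop :=
  letI : TopologicalSpace (X.forms 1) := moduleTopology ℝ (X.forms 1)
  IsLocalMin (fun l' : Fin k → X.forms 1 => objective f l') l

/-- `l` satisfies the first- and second-order optimality conditions for the target `f`: the gradient
of the objective (a polynomial function on `R_1^k`) vanishes at `l` and its Hessian is positive
semidefinite there; both are evaluated along the lines `t ↦ l + t h` through `l`. -/
def IsSecondOrderStationary (f : X.forms 2) (l : Fin k → X.forms 1) : Prop :=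
  (∀ h : Fin k → X.forms 1, deriv (fun t : ℝ => objective f (l + t • h)) 0 = 0) ∧
  (∀ h : Fin k → X.forms 1, 0 ≤ iteratedDeriv 2 (fun t : ℝ => objective f (l + t • h)) 0)

/-- A spurious second-order stationary point for the target `f`. -/
def IsSpuriousSOSP (f : X.forms 2) (l : Fin k → X.forms 1) : Prop :=
  IsSecondOrderStationary f l ∧ ¬ IsGlobalMin f l

/-- A spurious local minimum for the target `f`. -/
def IsSpuriousLocalMin (f : X.forms 2) (l : Fin k → X.forms 1) : Prop :=
  IsLocalMinimum f l ∧ ¬ IsGlobalMin f l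

/-- There is `g ⊥ ⟨l⟩_2` outside `Σ_X^*` with `⟨g, σ_k(h)⟩ ≥ 0` for all linear syzygies `h` of `l`,
where equality can hold only if `g ⊥ ⟨h⟩_2`. -/
def SyzygyCondition (l : Fin k → X.forms 1) : Prop :=
  ∃ g : X.forms 2, IsOrthTo g (quadPart l) ∧ g ∉ X.sosDual ∧
    ∀ h ∈ linSyz l, 0 ≤ pairing g (sumSq h) ∧
      (pairing g (sumSq h) = 0 → IsOrthTo g (quadPart h))

end Optimization

end RealProjectiveVariety

end

/-! Write `μ` for the product R_1 × R_1 → R_2, summed over tuples, and σ(h) = μ(h, h). With residual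
g = σ(l) - f, stationarity says g ⊥ μ(l, ·), and the Hessian condition says 2‖μ(l, h)‖² + ⟨g, σ(h)⟩
≥ 0. Hence g itself witnesses the syzygy condition: equality on a syzygy propagates by a
discriminant argument, and a better point of the cone pairs negatively with g.

Conversely, given a witness g, take f = σ(l) - εg. Modulo the radical N of ⟨g, μ(x, y)⟩, the form
⟨g, σ(h)⟩ is positive on nonzero syzygies, so by Finsler's lemma it becomes positive semidefinite
after adding C‖π μ(l, h)‖², where π projects along μ(l, N) (`IsSyzygyWitness.exists_bound`). A small
ε then gives the second-order conditions.

For a local minimum, split a perturbation as v = u + y with u in the span of l. Changing basis by a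
matrix near 1 absorbs the cross term μ(u, y) into μ(l, ·). Real radicality bounds ‖σ(y)‖ by the
change w of σ, which gives ⟨g, w⟩ ≥ -const · ‖w‖², and this is dominated by ‖w‖² for small ε
(`IsSyzygyWitness.exists_isLocalMin`). -/

open Filter Topology
open scoped RealInnerProductSpace

/-! ### Compactness and linear algebra -/

/-- A strict form of Finsler's lemma: a continuous `2`-homogeneous function that is positive on the
nonzero zeros of a nonnegative one becomes positive definite after adding a multiple of it. -/
theorem exists_mul_sq_norm_le_add_mul {E : Type*} [NormedAddCommGroup E] [NormedSpace ℝ E]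
    [FiniteDimensional ℝ E] {p r : E → ℝ} (hp : Continuous p) (hr : Continuous r)
    (hp2 : ∀ (t : ℝ) x, p (t • x) = t ^ 2 * p x) (hr2 : ∀ (t : ℝ) x, r (t • x) = t ^ 2 * r x)
    (hr0 : ∀ x, 0 ≤ r x) (h : ∀ x, x ≠ 0 → r x = 0 → 0 < p x) :
    ∃ C > 0, ∃ c > 0, ∀ x, c * ‖x‖ ^ 2 ≤ p x + C * r x := by
  have hK : IsCompact (Metric.sphere (0 : E) 1) := isCompact_sphere 0 1
  -- The sets increase with `m` because `r ≥ 0`, so a single one covers the sphere; `m + 1` keeps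
  -- the multiplier positive.
  obtain ⟨m, hm⟩ := hK.elim_directed_cover (fun m : ℕ => {x | 0 < p x + (m + 1 : ℝ) * r x})
    (fun m => isOpen_lt continuous_const (by fun_prop))
    (by
      intro x hx
      have hx0 : x ≠ 0 := by
        rintro rfl
        simp at hx
      rcases (hr0 x).eq_or_lt with h0 | h0
      · exact Set.mem_iUnion.2 ⟨0, by simpa [← h0] using h x hx0 h0.symm⟩
      · obtain ⟨m, hm⟩ := exists_nat_gt (-p x / r x)
        refine Set.mem_iUnion.2 ⟨m, ?_⟩
        rw [div_lt_iff₀ h0] at hm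
        change 0 < p x + (m + 1 : ℝ) * r x
        linarith)
    (by
      refine directed_of_isDirected_le fun a b hab x (hx : 0 < p x + (a + 1 : ℝ) * r x) => ?_
      have : (a : ℝ) ≤ b := by exact_mod_cast hab
      have := mul_le_mul_of_nonneg_right this (hr0 x)
      change 0 < p x + (b + 1 : ℝ) * r x
      linarith)
  have key : ∃ c > 0, ∀ x ∈ Metric.sphere (0 : E) 1, c ≤ p x + (m + 1 : ℝ) * r x := by
    rcases (Metric.sphere (0 : E) 1).eq_empty_or_nonempty with he | hne
    · exact ⟨1, one_pos, fun x hx => absurd (he ▸ hx) (Set.notMem_empty x)⟩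
    · obtain ⟨x, hx, hmin⟩ := hK.exists_isMinOn hne
        (f := fun x => p x + (m + 1 : ℝ) * r x) (by fun_prop)
      exact ⟨_, hm hx, fun y hy => hmin hy⟩
  obtain ⟨c, hc, hcx⟩ := key
  refine ⟨m + 1, by positivity, c, hc, fun x => ?_⟩
  rcases eq_or_ne x 0 with rfl | hx
  · have h1 := hp2 0 0
    have h2 := hr2 0 0
    simp only [zero_smul] at h1 h2
    rw [h1, h2, norm_zero]
    simp
  · have hn : 0 < ‖x‖ := norm_pos_iff.2 hx
    have h1 := hcx (‖x‖⁻¹ • x) (by simp [norm_smul, hn.ne'])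
    have h2 := mul_le_mul_of_nonneg_left h1 (sq_nonneg ‖x‖)
    rw [hp2, hr2] at h2
    have h3 : ‖x‖ ^ 2 * ‖x‖⁻¹ ^ 2 = 1 := by field_simp
    calc c * ‖x‖ ^ 2 = ‖x‖ ^ 2 * c := mul_comm _ _
      _ ≤ _ := h2
      _ = (‖x‖ ^ 2 * ‖x‖⁻¹ ^ 2) * (p x + (m + 1) * r x) := by ring
      _ = _ := by rw [h3, one_mul]

/-- Every subspace is the kernel of a linear projection. -/
theorem Submodule.exists_projection_with_ker {K V : Type*} [Field K] [AddCommGroup V] [Module K V]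
    (N : Submodule K V) :
    ∃ P : V →ₗ[K] V, (∀ x, P x = 0 ↔ x ∈ N) ∧ (∀ x, x - P x ∈ N) ∧ ∀ x, P (P x) = P x := by
  obtain ⟨s, hs⟩ := N.mkQ.exists_rightInverse_of_surjective N.range_mkQ
  have hs' : ∀ q, N.mkQ (s q) = q := fun q => LinearMap.congr_fun hs q
  have hN : ∀ x, N.mkQ x = 0 ↔ x ∈ N := fun x => by simp
  refine ⟨s ∘ₗ N.mkQ, fun x => ?_, fun x => ?_, fun x => ?_⟩
  · rw [← hN x, LinearMap.comp_apply]
    refine ⟨fun h => ?_, fun h => by rw [h, map_zero]⟩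
    rw [← hs' (N.mkQ x), h, map_zero]
  · rw [← hN, LinearMap.comp_apply, map_sub, hs', sub_self]
  · simp only [LinearMap.comp_apply, hs']

/-- Coefficients of the elements of the span of a finite family can be chosen linearly. -/
theorem exists_linear_coefficients {K V : Type*} [Field K] [AddCommGroup V] [Module K V]
    {ι : Type*} [Fintype ι] (l : ι → V) :
    ∃ D : V →ₗ[K] (ι → K), ∀ x ∈ Submodule.span K (Set.range l), ∑ j, D x j • l j = x := by
  obtain ⟨s, hs⟩ := (Fintype.linearCombination K l).rangeRestrict.exists_rightInverse_of_surjective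
    (LinearMap.range_rangeRestrict _)
  obtain ⟨D, hD⟩ := s.exists_extend
  refine ⟨D, fun x hx => ?_⟩
  rw [← Fintype.range_linearCombination K l] at hx
  have h1 : D x = s ⟨x, hx⟩ := LinearMap.congr_fun hD ⟨x, hx⟩
  have h2 := congrArg Subtype.val (LinearMap.congr_fun hs ⟨x, hx⟩)
  simpa [h1, Fintype.linearCombination_apply] using h2

/-! ### Quartics in one variable -/

section Quartic

variable (c₀ c₁ c₂ c₃ c₄ : ℝ)

theorem hasDerivAt_quartic (t : ℝ) :
    HasDerivAt (fun t : ℝ => c₀ + c₁ * t + c₂ * t ^ 2 + c₃ * t ^ 3 + c₄ * t ^ 4)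
      (c₁ + 2 * c₂ * t + 3 * c₃ * t ^ 2 + 4 * c₄ * t ^ 3) t := by
  have h := (((((hasDerivAt_id t).const_mul c₁).const_add c₀).add
    (((hasDerivAt_id t).pow 2).const_mul c₂)).add
    (((hasDerivAt_id t).pow 3).const_mul c₃)).add (((hasDerivAt_id t).pow 4).const_mul c₄)
  refine (h.congr_deriv ?_)
  simp
  ring

theorem deriv_quartic_zero :
    deriv (fun t : ℝ => c₀ + c₁ * t + c₂ * t ^ 2 + c₃ * t ^ 3 + c₄ * t ^ 4) 0 = c₁ := by
  simpa using (hasDerivAt_quartic c₀ c₁ c₂ c₃ c₄ 0).deriv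

theorem iteratedDeriv_two_quartic_zero :
    iteratedDeriv 2 (fun t : ℝ => c₀ + c₁ * t + c₂ * t ^ 2 + c₃ * t ^ 3 + c₄ * t ^ 4) 0
      = 2 * c₂ := by
  have h : deriv (fun t : ℝ => c₀ + c₁ * t + c₂ * t ^ 2 + c₃ * t ^ 3 + c₄ * t ^ 4) =
      fun t : ℝ => c₁ + (2 * c₂) * t + (3 * c₃) * t ^ 2 + (4 * c₄) * t ^ 3 + 0 * t ^ 4 := by
    funext t
    rw [(hasDerivAt_quartic c₀ c₁ c₂ c₃ c₄ t).deriv]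
    ring
  rw [iteratedDeriv_succ, iteratedDeriv_one, h, deriv_quartic_zero]

variable {c₀ c₁ c₂ c₃ c₄}

/-- Once the linear coefficient is gone, divide the increment by t² and let t → 0. -/
theorem IsLocalMin.quartic_coeffs
    (h : IsLocalMin (fun t : ℝ => c₀ + c₁ * t + c₂ * t ^ 2 + c₃ * t ^ 3 + c₄ * t ^ 4) 0) :
    c₁ = 0 ∧ 0 ≤ c₂ := by
  have h1 : c₁ = 0 := by
    rw [← deriv_quartic_zero c₀ c₁ c₂ c₃ c₄]
    exact h.deriv_eq_zero
  refine ⟨h1, ?_⟩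
  have ht : Tendsto (fun t : ℝ => c₂ + c₃ * t + c₄ * t ^ 2) (𝓝[≠] 0) (𝓝 c₂) := by
    have : Continuous fun t : ℝ => c₂ + c₃ * t + c₄ * t ^ 2 := by fun_prop
    simpa using (this.tendsto 0).mono_left nhdsWithin_le_nhds
  refine ge_of_tendsto ht ?_
  have h2 : ∀ᶠ t in 𝓝[≠] (0 : ℝ), _ := nhdsWithin_le_nhds h
  filter_upwards [h2, self_mem_nhdsWithin] with t ht (ht0 : t ≠ 0)
  subst h1
  have h3 : 0 < t ^ 2 := by positivity
  refine le_of_mul_le_mul_left ?_ h3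
  nlinarith [ht]

end Quartic

/-! ### Sums of squares for a symmetric bilinear map -/

section SumMul

variable {V W : Type*} [AddCommGroup V] [Module ℝ V] {k m : ℕ}

section Algebra

variable [AddCommGroup W] [Module ℝ W] (μ : V →ₗ[ℝ] V →ₗ[ℝ] W)

/-- The bilinear map `(l, h) ↦ ∑ i, μ (l i) (h i)` on tuples induced by a bilinear map `μ`. -/
noncomputable def sumMul : (Fin k → V) →ₗ[ℝ] (Fin k → V) →ₗ[ℝ] W :=
  ∑ i, μ.compl₁₂ (LinearMap.proj i) (LinearMap.proj i)

theorem sumMul_apply (l h : Fin k → V) : sumMul μ l h = ∑ i, μ (l i) (h i) := by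
  simp [sumMul, LinearMap.sum_apply]

theorem sumMul_comm (hμ : ∀ x y, μ x y = μ y x) (l h : Fin k → V) :
    sumMul μ l h = sumMul μ h l := by
  simp only [sumMul_apply]
  exact Finset.sum_congr rfl fun i _ => hμ _ _

theorem sumMul_add_self (hμ : ∀ x y, μ x y = μ y x) (l h : Fin k → V) :
    sumMul μ (l + h) (l + h) = sumMul μ l l + (2 : ℝ) • sumMul μ l h + sumMul μ h h := by
  simp only [map_add, LinearMap.add_apply, sumMul_comm μ hμ h l]
  module

theorem sumMul_smul_self (t : ℝ) (h : Fin k → V) :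
    sumMul μ (t • h) (t • h) = t ^ 2 • sumMul μ h h := by
  simp only [map_smul, LinearMap.smul_apply, smul_smul, sq]

theorem sumMul_append (a : Fin k → V) (b : Fin m → V) :
    sumMul μ (Fin.append a b) (Fin.append a b) = sumMul μ a a + sumMul μ b b := by
  simp [sumMul_apply, Fin.sum_univ_add]

/-- The transpose action `v ↦ (1 + Mᵀ) v` of a perturbation of the identity matrix on tuples. -/
noncomputable def rowMix (M : Fin k → Fin k → ℝ) (v : Fin k → V) : Fin k → V :=
  fun j => v j + ∑ i, M i j • v i

theorem rowMix_zero (v : Fin k → V) : rowMix 0 v = v := by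
  ext j
  simp [rowMix]

theorem rowMix_smul (M : Fin k → Fin k → ℝ) (t : ℝ) (v : Fin k → V) :
    rowMix M (t • v) = t • rowMix M v := by
  ext j
  simp only [rowMix, Pi.smul_apply, smul_add, Finset.smul_sum]
  congr 1
  exact Finset.sum_congr rfl fun i _ => smul_comm _ _ _

theorem rowMix_mem {N : Submodule ℝ V} (M : Fin k → Fin k → ℝ) {v : Fin k → V}
    (hv : ∀ i, v i ∈ N) (j : Fin k) : rowMix M v j ∈ N :=
  N.add_mem (hv j) (N.sum_mem fun i _ => N.smul_mem _ (hv i))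

theorem map_rowMix (P : V →ₗ[ℝ] V) (M : Fin k → Fin k → ℝ) (v : Fin k → V) :
    P.compLeft (Fin k) (rowMix M v) = rowMix M (P.compLeft (Fin k) v) := by
  ext j
  simp [rowMix]

/-- Adding a linear transform `M l` of `l` to `l` amounts to transforming the other argument. -/
theorem sumMul_rowMix (M : Fin k → Fin k → ℝ) (l u v : Fin k → V)
    (hu : ∀ i, ∑ j, M i j • l j = u i) :
    sumMul μ l (rowMix M v) = sumMul μ l v + sumMul μ u v := by
  simp only [sumMul_apply, rowMix, map_add, map_sum, map_smul, Finset.sum_add_distrib]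
  congr 1
  rw [Finset.sum_comm]
  refine Finset.sum_congr rfl fun i _ => ?_
  simp [← hu i, map_sum, LinearMap.sum_apply]

/-- The set of sums of squares with respect to `μ`. -/
def sumSquares : Set W := {q | ∃ (m : ℕ) (a : Fin m → V), q = sumMul μ a a}

end Algebra

/-! ### Syzygy witnesses and second-order conditions -/

section Inner

variable [NormedAddCommGroup W] [InnerProductSpace ℝ W] (μ : V →ₗ[ℝ] V →ₗ[ℝ] W) (g : W)

/-- The radical `{x | ∀ y, ⟪g, μ x y⟫ = 0}` of the bilinear form `⟪g, μ x y⟫`. -/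
noncomputable def formRadical : Submodule ℝ V := LinearMap.ker (μ.compr₂ (innerₗ W g))

variable {μ g}

theorem mem_formRadical {x : V} : x ∈ formRadical μ g ↔ ∀ y, ⟪g, μ x y⟫ = 0 := by
  rw [formRadical, LinearMap.mem_ker, LinearMap.ext_iff]
  rfl

theorem forall_mem_formRadical {h : Fin k → V} :
    (∀ i, h i ∈ formRadical μ g) ↔ ∀ p : Fin k → V, ⟪g, sumMul μ h p⟫ = 0 := by
  constructor
  · intro hh p
    rw [sumMul_apply, inner_sum]
    exact Finset.sum_eq_zero fun i _ => mem_formRadical.1 (hh i) (p i)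
  · intro hh i
    refine mem_formRadical.2 fun y => ?_
    have := hh (Pi.single i y)
    rw [sumMul_apply, Finset.sum_eq_single i] at this
    · simpa using this
    · intro j _ hj
      simp [Pi.single_eq_of_ne hj]
    · simp

/-- The form ⟨g, σ(·)⟩ descends to the quotient by its radical. -/
theorem inner_sumMul_self_eq_of_sub_mem (hμ : ∀ x y, μ x y = μ y x) {x y : Fin k → V}
    (h : ∀ i, (x - y) i ∈ formRadical μ g) : ⟪g, sumMul μ x x⟫ = ⟪g, sumMul μ y y⟫ := by
  have h1 := forall_mem_formRadical.1 h
  have h2 := sumMul_add_self μ hμ y (x - y)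
  rw [add_sub_cancel, sumMul_comm μ hμ y (x - y)] at h2
  rw [h2, inner_add_right, inner_add_right, inner_smul_right, h1, h1, mul_zero, add_zero, add_zero]

variable (μ) in
/-- `g` annihilates `μ(l, ·)` and is negative on some sum of squares, while `⟪g, μ(h, h)⟫` is
nonnegative on the syzygies `h` of `l` and vanishes only at those that `g` annihilates. -/
structure IsSyzygyWitness (l : Fin k → V) (g : W) : Prop where
  inner_left : ∀ h, ⟪g, sumMul μ l h⟫ = 0
  exists_neg : ∃ q ∈ sumSquares μ, ⟪g, q⟫ < 0
  nonneg : ∀ h : Fin k → V, sumMul μ l h = 0 → 0 ≤ ⟪g, sumMul μ h h⟫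
  inner_of_eq_zero : ∀ h : Fin k → V, sumMul μ l h = 0 → ⟪g, sumMul μ h h⟫ = 0 →
    ∀ p, ⟪g, sumMul μ h p⟫ = 0

variable (μ) in
/-- The first- and second-order optimality conditions at `l` for the objective
`l ↦ ‖∑ i, μ (l i) (l i) - f‖ ^ 2`, in expanded form. -/
structure IsSecondOrderCritical (f : W) (l : Fin k → V) : Prop where
  first : ∀ h, ⟪sumMul μ l l - f, sumMul μ l h⟫ = 0
  second : ∀ h, 0 ≤ 2 * ‖sumMul μ l h‖ ^ 2 + ⟪sumMul μ l l - f, sumMul μ h h⟫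

theorem norm_sumMul_line_sub_sq (hμ : ∀ x y, μ x y = μ y x) (f : W) (l h : Fin k → V) (t : ℝ) :
    ‖sumMul μ (l + t • h) (l + t • h) - f‖ ^ 2 =
      ‖sumMul μ l l - f‖ ^ 2 + (4 * ⟪sumMul μ l l - f, sumMul μ l h⟫) * t
      + (4 * ‖sumMul μ l h‖ ^ 2 + 2 * ⟪sumMul μ l l - f, sumMul μ h h⟫) * t ^ 2
      + (4 * ⟪sumMul μ l h, sumMul μ h h⟫) * t ^ 3 + ‖sumMul μ h h‖ ^ 2 * t ^ 4 := by
  have h1 : sumMul μ (l + t • h) (l + t • h) - f =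
      (sumMul μ l l - f) + ((2 * t) • sumMul μ l h + t ^ 2 • sumMul μ h h) := by
    rw [sumMul_add_self μ hμ, sumMul_smul_self, map_smul]
    module
  rw [h1, norm_add_sq_real, norm_add_sq_real, inner_add_right]
  simp only [inner_smul_right, real_inner_smul_left, norm_smul, mul_pow, Real.norm_eq_abs, sq_abs]
  ring

theorem isSecondOrderCritical_iff_deriv (hμ : ∀ x y, μ x y = μ y x) (f : W) (l : Fin k → V) :
    IsSecondOrderCritical μ f l ↔
      (∀ h, deriv (fun t : ℝ => ‖sumMul μ (l + t • h) (l + t • h) - f‖ ^ 2) 0 = 0) ∧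
      ∀ h, 0 ≤ iteratedDeriv 2 (fun t : ℝ => ‖sumMul μ (l + t • h) (l + t • h) - f‖ ^ 2) 0 := by
  simp only [norm_sumMul_line_sub_sq hμ, deriv_quartic_zero, iteratedDeriv_two_quartic_zero]
  refine ⟨fun ⟨h1, h2⟩ => ⟨fun h => by rw [h1, mul_zero], fun h => by linarith [h2 h]⟩,
    fun ⟨h1, h2⟩ => ⟨fun h => by linarith [h1 h], fun h => by linarith [h2 h]⟩⟩

/-- The residual is the witness: the term 2‖μ(l, h)‖² of the Hessian disappears on syzygies. -/
theorem IsSecondOrderCritical.isSyzygyWitness (hμ : ∀ x y, μ x y = μ y x) {f : W} {l : Fin k → V}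
    (h : IsSecondOrderCritical μ f l)
    (hmin : ∃ q ∈ sumSquares μ, ‖q - f‖ ^ 2 < ‖sumMul μ l l - f‖ ^ 2) :
    IsSyzygyWitness μ l (sumMul μ l l - f) where
  inner_left := h.first
  exists_neg := by
    obtain ⟨q, hq, hlt⟩ := hmin
    refine ⟨q, hq, ?_⟩
    -- Since g ⊥ σ(l), ‖q - f‖² = ‖g‖² + 2⟨g, q⟩ + ‖q - σ(l)‖².
    rw [show q - f = (sumMul μ l l - f) + (q - sumMul μ l l) by abel, norm_add_sq_real,
      inner_sub_right, h.first] at hlt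
    nlinarith [sq_nonneg ‖q - sumMul μ l l‖]
  nonneg p hp := by simpa [hp] using h.second p
  inner_of_eq_zero p hp hp0 x := by
    -- The Hessian condition along `p + t • x` is a quadratic in t without constant term, so
    -- nonnegativity kills its linear coefficient.
    have key : ∀ t : ℝ, 0 ≤ (2 * ‖sumMul μ l x‖ ^ 2 + ⟪sumMul μ l l - f, sumMul μ x x⟫) * (t * t)
        + (2 * ⟪sumMul μ l l - f, sumMul μ p x⟫) * t + 0 := by
      intro t
      have := h.second (p + t • x)
      rw [sumMul_add_self μ hμ, sumMul_smul_self, map_add, hp, zero_add, map_smul, map_smul,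
        norm_smul, inner_add_right, inner_add_right, hp0] at this
      simp only [inner_smul_right, mul_pow, Real.norm_eq_abs, sq_abs] at this
      linarith
    have := discrim_le_zero key
    simp only [discrim, mul_zero, sub_zero] at this
    nlinarith

/-- Moving from σ(l) to σ(l) + t²q with ⟨g, q⟩ < 0 decreases the distance for small t ≠ 0. This may
use more than k squares, so it only refutes minimality over the whole cone. -/
theorem IsSyzygyWitness.exists_norm_sub_sq_lt {l : Fin k → V} (h : IsSyzygyWitness μ l g) {ε : ℝ}
    (hε : 0 < ε) :
    ∃ q ∈ sumSquares μ, ‖q - (sumMul μ l l - ε • g)‖ ^ 2 <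
      ‖sumMul μ l l - (sumMul μ l l - ε • g)‖ ^ 2 := by
  obtain ⟨_, ⟨m, a, rfl⟩, hneg⟩ := h.exists_neg
  set q := sumMul μ a a
  have ht : ∃ t : ℝ, t ≠ 0 ∧ t ^ 2 * ‖q‖ ^ 2 + 2 * ε * ⟪g, q⟫ < 0 := by
    have hc : Tendsto (fun t : ℝ => t ^ 2 * ‖q‖ ^ 2 + 2 * ε * ⟪g, q⟫) (𝓝[≠] 0)
        (𝓝 (2 * ε * ⟪g, q⟫)) := by
      have : Continuous fun t : ℝ => t ^ 2 * ‖q‖ ^ 2 + 2 * ε * ⟪g, q⟫ := by fun_prop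
      simpa using (this.tendsto 0).mono_left nhdsWithin_le_nhds
    have hneg' : 2 * ε * ⟪g, q⟫ < 0 := mul_neg_of_pos_of_neg (by linarith) hneg
    obtain ⟨t, h1, h2⟩ := ((hc.eventually_lt_const hneg').and self_mem_nhdsWithin).exists
    exact ⟨t, h2, h1⟩
  obtain ⟨t, ht0, ht⟩ := ht
  refine ⟨_, ⟨k + m, Fin.append l (t • a), rfl⟩, ?_⟩
  rw [sumMul_append, sumMul_smul_self,
    show sumMul μ l l + t ^ 2 • q - (sumMul μ l l - ε • g) = ε • g + t ^ 2 • q by abel,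
    sub_sub_cancel, norm_add_sq_real, real_inner_smul_left, inner_smul_right, norm_smul (t ^ 2),
    mul_pow, Real.norm_eq_abs, sq_abs]
  have h3 : 0 < t ^ 2 := by positivity
  nlinarith [mul_neg_of_pos_of_neg h3 ht]

end Inner

end SumMul

/-! ### From a witness to stationary points and local minima -/

section LocalMinimum

variable {V W : Type*} [NormedAddCommGroup V] [NormedSpace ℝ V] {k : ℕ}
  [NormedAddCommGroup W] [InnerProductSpace ℝ W] {μ : V →ₗ[ℝ] V →ₗ[ℝ] W} {g : W}

theorem Continuous.rowMix {T : Type*} [TopologicalSpace T] {M : T → Fin k → Fin k → ℝ}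
    {v : T → Fin k → V} (hM : Continuous M) (hv : Continuous v) :
    Continuous fun x => rowMix (M x) (v x) := by
  unfold _root_.rowMix
  fun_prop

theorem IsLocalMin.isSecondOrderCritical (hμ : ∀ x y, μ x y = μ y x) {f : W} {l : Fin k → V}
    (h : IsLocalMin (fun l' => ‖sumMul μ l' l' - f‖ ^ 2) l) : IsSecondOrderCritical μ f l := by
  have key : ∀ v : Fin k → V, 4 * ⟪sumMul μ l l - f, sumMul μ l v⟫ = 0 ∧
      0 ≤ 4 * ‖sumMul μ l v‖ ^ 2 + 2 * ⟪sumMul μ l l - f, sumMul μ v v⟫ := fun v => by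
    have hc : Continuous fun t : ℝ => l + t • v := by fun_prop
    have h0 : l + (0 : ℝ) • v = l := by simp
    have h1 : IsLocalMin (fun l' => ‖sumMul μ l' l' - f‖ ^ 2) (l + (0 : ℝ) • v) := by rwa [h0]
    have h2 := h1.comp_continuous (g := fun t : ℝ => l + t • v) hc.continuousAt
    simp only [Function.comp_def, norm_sumMul_line_sub_sq hμ] at h2
    exact h2.quartic_coeffs
  exact ⟨fun v => by linarith [(key v).1], fun v => by linarith [(key v).2]⟩

variable [FiniteDimensional ℝ V]

variable (μ) in
theorem Continuous.sumMul {T : Type*} [TopologicalSpace T] {a b : T → Fin k → V}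
    (ha : Continuous a) (hb : Continuous b) : Continuous fun x => sumMul μ (a x) (b x) := by
  have h : Continuous fun x => (_root_.sumMul μ).toContinuousBilinearMap (a x) (b x) := by fun_prop
  exact h

variable (μ) in
theorem exists_norm_sumMul_self_le :
    ∃ K : ℝ, 0 ≤ K ∧ ∀ v : Fin k → V, ‖sumMul μ v v‖ ≤ K * ‖v‖ ^ 2 := by
  refine ⟨‖(sumMul (k := k) μ).toContinuousBilinearMap‖,
    ContinuousLinearMap.opNorm_nonneg _, fun v => ?_⟩
  have := (sumMul (k := k) μ).toContinuousBilinearMap.le_opNorm₂ v v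
  rw [sq, ← mul_assoc]
  exact this

/-- The form `⟪g, μ(h, h)⟫` is bounded below by a multiple of the squared distance of `μ(l, h)` to
`μ(l, N)`, and strictly so modulo the radical `N`. -/
theorem IsSyzygyWitness.exists_bound [FiniteDimensional ℝ W] (hμ : ∀ x y, μ x y = μ y x)
    {l : Fin k → V} (h : IsSyzygyWitness μ l g) :
    ∃ (P : V →ₗ[ℝ] V) (π : W →L[ℝ] W), (∀ x, x - P x ∈ formRadical μ g) ∧
      (∀ w, ‖π w‖ ≤ ‖w‖) ∧
      (∀ n : Fin k → V, (∀ i, n i ∈ formRadical μ g) → π (sumMul μ l n) = 0) ∧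
      ∃ C > 0, ∃ c > 0, ∀ v : Fin k → V, c * ‖P.compLeft (Fin k) v‖ ^ 2 ≤
        ⟪g, sumMul μ v v⟫ + C * ‖π (sumMul μ l v)‖ ^ 2 := by
  obtain ⟨P, hP0, hPN, hPP⟩ := (formRadical μ g).exists_projection_with_ker
  let N : Submodule ℝ (Fin k → V) := LinearMap.ker (P.compLeft (Fin k))
  have hN : ∀ v, v ∈ N ↔ ∀ i, v i ∈ formRadical μ g := fun v => by
    simp [N, LinearMap.mem_ker, funext_iff, hP0]
  let S : Submodule ℝ W := N.map (sumMul μ l)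
  let π : W →L[ℝ] W := Sᗮ.starProjection
  have hπ : ∀ w, π w = 0 ↔ w ∈ S := fun w => by
    rw [Submodule.starProjection_apply_eq_zero_iff, Submodule.orthogonal_orthogonal]
  have hπN : ∀ n : Fin k → V, (∀ i, n i ∈ formRadical μ g) → π (sumMul μ l n) = 0 :=
    fun n hn => (hπ _).2 ⟨n, (hN n).2 hn, rfl⟩
  have hsub : ∀ v : Fin k → V, ∀ i, (v - P.compLeft (Fin k) v) i ∈ formRadical μ g :=
    fun v i => hPN (v i)
  refine ⟨P, π, hPN, fun w => Submodule.norm_starProjection_apply_le _ _, hπN, ?_⟩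
  let U : Submodule ℝ (Fin k → V) := LinearMap.range (P.compLeft (Fin k))
  have hUc : Continuous fun v : U => (v : Fin k → V) := continuous_subtype_val
  obtain ⟨C, hC, c, hc, hb⟩ := exists_mul_sq_norm_le_add_mul (E := U)
    (p := fun v => ⟪g, sumMul μ (v : Fin k → V) v⟫)
    (r := fun v => ‖π (sumMul μ l (v : Fin k → V))‖ ^ 2)
    (continuous_const.inner (hUc.sumMul μ hUc))
    ((π.continuous.comp (continuous_const.sumMul μ hUc)).norm.pow 2)
    (fun t v => by
      rw [Submodule.coe_smul, sumMul_smul_self, inner_smul_right])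
    (fun t v => by
      rw [Submodule.coe_smul, map_smul, map_smul, norm_smul, mul_pow, Real.norm_eq_abs, sq_abs])
    (fun v => by positivity)
    (by
      -- If π kills μ(l, v), some n with entries in the radical makes v - n a syzygy with the same
      -- value of the form. A zero value would put v - n, hence v, in the kernel of P; but v is in
      -- its range, so v = 0.
      rintro ⟨v, hv⟩ hv0 hr
      simp only [ne_eq, Submodule.mk_eq_zero, OfNat.ofNat_ne_zero, not_false_eq_true,
        pow_eq_zero_iff, norm_eq_zero] at hv0 hr
      obtain ⟨n, hn, hln⟩ := (hπ _).1 hr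
      have hs : sumMul μ l (v - n) = 0 := by rw [map_sub, hln, sub_self]
      have hQ : ⟪g, sumMul μ (v - n) (v - n)⟫ = ⟪g, sumMul μ v v⟫ :=
        inner_sumMul_self_eq_of_sub_mem hμ ((hN _).1 (by simpa using hn))
      change 0 < ⟪g, sumMul μ v v⟫
      rw [← hQ]
      refine (h.nonneg _ hs).lt_of_ne fun h0 => hv0 ?_
      have h1 := (hN _).2 (forall_mem_formRadical.2 (h.inner_of_eq_zero _ hs h0.symm))
      have h2 : v ∈ N := by simpa using N.add_mem h1 hn
      obtain ⟨u, rfl⟩ := hv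
      rw [← LinearMap.mem_ker.1 h2]
      ext i
      simp [hPP])
  refine ⟨C, hC, c, hc, fun v => ?_⟩
  have h1 := hb ⟨P.compLeft (Fin k) v, ⟨v, rfl⟩⟩
  rw [inner_sumMul_self_eq_of_sub_mem hμ (hsub v)]
  have h2 : π (sumMul μ l v) = π (sumMul μ l (P.compLeft (Fin k) v)) := by
    rw [← sub_eq_zero, ← map_sub, ← map_sub]
    exact hπN _ (hsub v)
  rw [h2]
  exact h1

theorem IsSyzygyWitness.exists_isSecondOrderCritical [FiniteDimensional ℝ W]
    (hμ : ∀ x y, μ x y = μ y x) {l : Fin k → V} (h : IsSyzygyWitness μ l g) :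
    ∃ ε > (0 : ℝ), IsSecondOrderCritical μ (sumMul μ l l - ε • g) l := by
  obtain ⟨P, π, -, hπ, -, C, hC, c, hc, hb⟩ := h.exists_bound hμ
  -- With ε = 2 / C the Hessian expression is 2 / C times ⟨g, σ(v)⟩ + C‖μ(l, v)‖².
  refine ⟨2 / C, by positivity, ⟨fun v => ?_, fun v => ?_⟩⟩
  · rw [sub_sub_cancel, real_inner_smul_left, h.inner_left, mul_zero]
  · rw [sub_sub_cancel, real_inner_smul_left]
    have h1 := hπ (sumMul μ l v)
    have h2 : 0 ≤ ⟪g, sumMul μ v v⟫ + C * ‖sumMul μ l v‖ ^ 2 :=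
      le_trans (by positivity) ((hb v).trans (by gcongr))
    have h3 : 2 * ‖sumMul μ l v‖ ^ 2 + 2 / C * ⟪g, sumMul μ v v⟫
        = 2 / C * (⟪g, sumMul μ v v⟫ + C * ‖sumMul μ l v‖ ^ 2) := by
      field_simp
      ring
    rw [h3]
    positivity

/-- A lower bound for `⟪g, μ(v, v)⟫` that is uniform under small changes of basis. -/
theorem IsSyzygyWitness.exists_bound_rowMix [FiniteDimensional ℝ W] (hμ : ∀ x y, μ x y = μ y x)
    {l : Fin k → V} (h : IsSyzygyWitness μ l g) :
    ∃ π : W →L[ℝ] W, (∀ w, ‖π w‖ ≤ ‖w‖) ∧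
      (∀ n : Fin k → V, (∀ i, n i ∈ formRadical μ g) → π (sumMul μ l n) = 0) ∧
      ∃ C > 0, ∀ᶠ M in 𝓝 (0 : Fin k → Fin k → ℝ), ∀ v : Fin k → V,
        -(C * ‖π (sumMul μ l (rowMix M v))‖ ^ 2) ≤ ⟪g, sumMul μ v v⟫ := by
  obtain ⟨P, π, hP, hπ, hπN, C, hC, c, hc, hb⟩ := h.exists_bound hμ
  refine ⟨π, hπ, hπN, C, hC, ?_⟩
  -- `F` measures how the lower bound degrades under `rowMix M`. At M = 0 it is c‖y‖², so
  -- compactness of the sphere and homogeneity keep it nonnegative for all M near 0.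
  let F : (Fin k → Fin k → ℝ) × (Fin k → V) → ℝ := fun z =>
    c * ‖rowMix z.1 z.2‖ ^ 2 - ⟪g, sumMul μ (rowMix z.1 z.2) (rowMix z.1 z.2)⟫
      + ⟪g, sumMul μ z.2 z.2⟫
  have hF : Continuous F := by
    have hm : Continuous fun z : (Fin k → Fin k → ℝ) × (Fin k → V) => rowMix z.1 z.2 :=
      continuous_fst.rowMix continuous_snd
    exact ((continuous_const.mul (hm.norm.pow 2)).sub
      (continuous_const.inner (hm.sumMul μ hm))).add
      (continuous_const.inner (continuous_snd.sumMul μ continuous_snd))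
  have hFt : ∀ M (t : ℝ) v, F (M, t • v) = t ^ 2 * F (M, v) := fun M t v => by
    simp only [F, rowMix_smul, sumMul_smul_self, inner_smul_right, norm_smul, mul_pow,
      Real.norm_eq_abs, sq_abs]
    ring
  have hev : ∀ᶠ M in 𝓝 (0 : Fin k → Fin k → ℝ), ∀ y ∈ Metric.sphere (0 : Fin k → V) 1,
      0 < F (M, y) := by
    refine (isCompact_sphere (0 : Fin k → V) 1).eventually_forall_of_forall_eventually
      fun y hy => ?_
    refine hF.continuousAt.eventually (lt_mem_nhds ?_)
    have hy1 : ‖y‖ = 1 := by simpa using hy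
    simpa [F, rowMix_zero, hy1] using hc
  filter_upwards [hev] with M hM v
  have hF0 : ∀ y, 0 ≤ F (M, y) := fun y => by
    rcases eq_or_ne y 0 with rfl | hy
    · have h0 := hFt M 0 0
      rw [smul_zero, zero_pow two_ne_zero, zero_mul] at h0
      exact h0.ge
    · have hn := norm_pos_iff.2 hy
      have h1 := hM (‖y‖⁻¹ • y) (by simp [norm_smul, hn.ne'])
      rw [hFt] at h1
      exact (pos_of_mul_pos_right h1 (by positivity)).le
  have hv : ∀ i, (v - P.compLeft (Fin k) v) i ∈ formRadical μ g := fun i => hP (v i)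
  have hv' : ∀ i, (rowMix M v - P.compLeft (Fin k) (rowMix M v)) i ∈ formRadical μ g :=
    fun i => hP _
  have h1 := hb (rowMix M v)
  have h2 := hF0 (P.compLeft (Fin k) v)
  simp only [F] at h2
  -- `P` acts on entries and so commutes with `rowMix`; both forms are thus evaluated on the
  -- projection of v.
  rw [inner_sumMul_self_eq_of_sub_mem hμ hv', map_rowMix] at h1
  rw [inner_sumMul_self_eq_of_sub_mem hμ hv]
  linarith

/-- If `σ(v)` lies in `μ(l, ·)` only for tuples `v` in the span of `l`, then small multiples of a
syzygy witness make `l` a local minimum. -/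
theorem IsSyzygyWitness.exists_isLocalMin [FiniteDimensional ℝ W] (hμ : ∀ x y, μ x y = μ y x)
    {l : Fin k → V} (h : IsSyzygyWitness μ l g)
    (hreal : ∀ v p : Fin k → V, sumMul μ v v = sumMul μ l p →
      ∀ i, v i ∈ Submodule.span ℝ (Set.range l)) :
    ∃ ε > (0 : ℝ), IsLocalMin (fun l' => ‖sumMul μ l' l' - (sumMul μ l l - ε • g)‖ ^ 2) l := by
  obtain ⟨π, hπ, hπN, C, hC, hb⟩ := h.exists_bound_rowMix hμ
  obtain ⟨P, hP0, hPL, hPP⟩ := (Submodule.span ℝ (Set.range l)).exists_projection_with_ker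
  obtain ⟨D, hD⟩ := exists_linear_coefficients (K := ℝ) l
  have hlN : ∀ i, l i ∈ formRadical μ g := forall_mem_formRadical.2 h.inner_left
  have hLN : Submodule.span ℝ (Set.range l) ≤ formRadical μ g :=
    Submodule.span_le.2 (by rintro _ ⟨i, rfl⟩; exact hlN i)
  -- the norm of `σ(v)` is controlled by its distance to `μ(l, ·)`
  obtain ⟨K, hK0, hK⟩ : ∃ K : ℝ, 0 ≤ K ∧ ∀ v p : Fin k → V,
      ‖sumMul μ (P.compLeft (Fin k) v) (P.compLeft (Fin k) v)‖ ≤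
        K * ‖sumMul μ (P.compLeft (Fin k) v) (P.compLeft (Fin k) v) + sumMul μ l p‖ := by
    obtain ⟨K, hK0, hK⟩ := exists_norm_sumMul_self_le (k := k) μ
    let S : Submodule ℝ W := LinearMap.range (sumMul μ l)
    let ρ : W →L[ℝ] W := Sᗮ.starProjection
    have hρ : ∀ w, ρ w = 0 ↔ w ∈ S := fun w => by
      rw [Submodule.starProjection_apply_eq_zero_iff, Submodule.orthogonal_orthogonal]
    let U : Submodule ℝ (Fin k → V) := LinearMap.range (P.compLeft (Fin k))
    have hUc : Continuous fun v : U => (v : Fin k → V) := continuous_subtype_val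
    -- With r = 0 only the compactness half of the Finsler lemma is used; positivity off zero is
    -- `hreal`.
    obtain ⟨C', -, c, hc, hcb⟩ := exists_mul_sq_norm_le_add_mul (E := U)
      (p := fun v => ‖ρ (sumMul μ (v : Fin k → V) v)‖) (r := fun _ => 0)
      (ρ.continuous.comp (hUc.sumMul μ hUc)).norm continuous_const
      (fun t v => by
        rw [Submodule.coe_smul, sumMul_smul_self, map_smul, norm_smul, Real.norm_eq_abs, abs_sq])
      (fun t v => by simp) (fun v => le_rfl)
      (by
        rintro ⟨v, hv⟩ hv0 -
        refine norm_pos_iff.2 fun h0 => hv0 ?_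
        obtain ⟨p, hp⟩ := (hρ _).1 h0
        obtain ⟨u, rfl⟩ := hv
        have h1 := hreal _ p hp.symm
        ext i
        simpa [hPP] using (hP0 _).2 (h1 i))
    refine ⟨K / c, by positivity, fun v p => ?_⟩
    set y := P.compLeft (Fin k) v
    have h1 := hcb ⟨y, ⟨v, rfl⟩⟩
    rw [mul_zero, add_zero] at h1
    have h2 : ρ (sumMul μ y y) = ρ (sumMul μ y y + sumMul μ l p) := by
      rw [map_add, (hρ (sumMul μ l p)).2 ⟨p, rfl⟩, add_zero]
    have h3 : c * ‖y‖ ^ 2 ≤ ‖sumMul μ y y + sumMul μ l p‖ :=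
      h1.trans (h2 ▸ Submodule.norm_starProjection_apply_le _ _)
    calc ‖sumMul μ y y‖ ≤ K * ‖y‖ ^ 2 := hK y
      _ = K / c * (c * ‖y‖ ^ 2) := by field_simp
      _ ≤ _ := by gcongr
  -- the coefficient matrix of the component of `v` in the span of `l`
  let M : (Fin k → V) → Fin k → Fin k → ℝ := fun v i => D ((v - P.compLeft (Fin k) v) i)
  have hM : Tendsto (fun l' => M (l' - l)) (𝓝 l) (𝓝 0) := by
    have hPc : Continuous (P.compLeft (Fin k)) := LinearMap.continuous_of_finiteDimensional _
    have hDc : Continuous D := LinearMap.continuous_of_finiteDimensional _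
    have hc : Continuous fun l' => M (l' - l) :=
      continuous_pi fun i => hDc.comp ((continuous_apply i).comp
        ((continuous_id.sub continuous_const).sub (hPc.comp (continuous_id.sub continuous_const))))
    have h0 : M (l - l) = 0 := by
      ext i j
      simp [M]
    exact h0 ▸ hc.tendsto l
  refine ⟨2 / (C * (1 + K) ^ 2), by positivity, ?_⟩
  filter_upwards [hM.eventually hb] with l' hl'
  obtain ⟨v, rfl⟩ : ∃ v, l' = l + v := ⟨l' - l, by abel⟩
  rw [add_sub_cancel_left] at hl'
  set y := P.compLeft (Fin k) v with hy
  set u := v - y with hu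
  have huL : ∀ i, u i ∈ Submodule.span ℝ (Set.range l) := fun i => hPL (v i)
  have huM : ∀ i, ∑ j, M v i j • l j = u i := fun i => hD _ (huL i)
  have hv : v = u + y := by rw [hu]; abel
  -- Chosen so that μ(l, z) = 2μ(l, u) + μ(u, u); its entries lie in the radical, so π annihilates
  -- μ(l, z).
  set z := rowMix (M v) u + u with hz
  have hzN : ∀ i, z i ∈ formRadical μ g := fun i =>
    Submodule.add_mem _ (rowMix_mem _ (fun i => hLN (huL i)) i) (hLN (huL i))
  have hw : sumMul μ (l + v) (l + v) - sumMul μ l l =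
      (2 : ℝ) • sumMul μ l (rowMix (M v) y) + sumMul μ y y + sumMul μ l z := by
    have hlz : sumMul μ l z = (2 : ℝ) • sumMul μ l u + sumMul μ u u := by
      rw [hz, map_add, sumMul_rowMix μ _ _ _ _ huM]
      module
    have hlv : sumMul μ l v = sumMul μ l u + sumMul μ l y := by rw [← map_add, ← hv]
    have hvv : sumMul μ v v = sumMul μ u u + (2 : ℝ) • sumMul μ u y + sumMul μ y y := by
      rw [← sumMul_add_self μ hμ, ← hv]
    rw [sumMul_rowMix μ _ _ _ _ huM, hlz, sumMul_add_self μ hμ, hlv, hvv]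
    module
  set w := sumMul μ (l + v) (l + v) - sumMul μ l l with hwdef
  have h1 : ‖sumMul μ y y‖ ≤ K * ‖w‖ := by
    have := hK v ((2 : ℝ) • rowMix (M v) y + z)
    rwa [← hy, map_add, map_smul, ← add_assoc, add_comm (sumMul μ y y), ← hw] at this
  have h2 : 2 * ‖π (sumMul μ l (rowMix (M v) y))‖ ≤ (1 + K) * ‖w‖ := by
    have h3 : (2 : ℝ) • π (sumMul μ l (rowMix (M v) y)) = π w - π (sumMul μ y y) := by
      rw [hw, map_add, map_add, map_smul, hπN z hzN]
      abel
    calc 2 * ‖π (sumMul μ l (rowMix (M v) y))‖ = ‖(2 : ℝ) • π (sumMul μ l (rowMix (M v) y))‖ := by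
          rw [norm_smul]; simp
      _ ≤ ‖π w‖ + ‖π (sumMul μ y y)‖ := h3 ▸ norm_sub_le _ _
      _ ≤ ‖w‖ + K * ‖w‖ := add_le_add (hπ _) ((hπ _).trans h1)
      _ = _ := by ring
  -- All other terms of w lie in μ(l, ·), which g annihilates.
  have h3 : ⟪g, w⟫ = ⟪g, sumMul μ y y⟫ := by
    rw [hw, inner_add_right, inner_add_right, inner_smul_right, h.inner_left, h.inner_left]
    simp
  have h4 : -(C * ((1 + K) * ‖w‖ / 2) ^ 2) ≤ ⟪g, w⟫ := by
    rw [h3]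
    refine le_trans ?_ (hl' y)
    gcongr
    linarith
  -- The value of ε makes 2ε · C(1 + K)² / 4 = 1, exactly balancing `h4` against ‖w‖².
  have h5 : 0 ≤ ‖w‖ ^ 2 + 2 * (2 / (C * (1 + K) ^ 2) * ⟪g, w⟫) := by
    have h6 : 0 ≤ 4 / (C * (1 + K) ^ 2) * (⟪g, w⟫ + C * ((1 + K) * ‖w‖ / 2) ^ 2) :=
      mul_nonneg (by positivity) (by linarith)
    refine h6.trans_eq ?_
    field_simp
    ring
  change _ ≤ ‖sumMul μ (l + v) (l + v) - _‖ ^ 2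
  rw [sub_sub_cancel, show sumMul μ (l + v) (l + v) - (sumMul μ l l -
      (2 / (C * (1 + K) ^ 2)) • g) = (2 / (C * (1 + K) ^ 2)) • g + w by rw [hwdef]; abel,
    norm_add_sq_real, real_inner_smul_left]
  linarith

end LocalMinimum

/-! ### Linear forms in the coordinate ring -/

namespace RealProjectiveVariety

variable {n : ℕ} (X : RealProjectiveVariety n) {k : ℕ}

/-- The multiplication `R_1 × R_1 → R_2` as a bilinear map. -/
noncomputable def mulFormsₗ : X.forms 1 →ₗ[ℝ] X.forms 1 →ₗ[ℝ] X.forms 2 :=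
  LinearMap.mk₂ ℝ mulForms
    (fun _ _ _ => Subtype.ext (add_mul _ _ _))
    (fun _ _ _ => Subtype.ext (smul_mul_assoc _ _ _))
    (fun _ _ _ => Subtype.ext (mul_add _ _ _))
    (fun _ _ _ => Subtype.ext (mul_smul_comm _ _ _))

theorem mulFormsₗ_comm (x y : X.forms 1) : X.mulFormsₗ x y = X.mulFormsₗ y x :=
  Subtype.ext (mul_comm _ _)

instance finite_forms (d : ℕ) : Module.Finite ℝ (X.forms d) :=
  Module.Finite.iff_fg.2 ((MvPolynomial.homogeneousSubmodule_fg _ _ d).map _)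

variable {X}

theorem sum_mulForms (l h : Fin k → X.forms 1) :
    ∑ i, mulForms (l i) (h i) = sumMul X.mulFormsₗ l h :=
  (sumMul_apply X.mulFormsₗ l h).symm

theorem sumSq_eq_sumMul (l : Fin k → X.forms 1) : sumSq l = sumMul X.mulFormsₗ l l :=
  sum_mulForms l l

theorem sosCone_eq_sumSquares : X.sosCone = sumSquares X.mulFormsₗ := by
  simp only [sosCone, sumSquares, sumSq_eq_sumMul]

/-- The vanishing ideal contains `x - ∑ aᵢ(0) lᵢ` with `x - ∑ aᵢ lᵢ`, where `x` and the `lᵢ` are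
linear forms. -/
theorem sub_sum_coeff_zero_smul_mem_vanishingIdeal
    {x : MvPolynomial (Fin (n + 1)) ℝ} {l a : Fin k → MvPolynomial (Fin (n + 1)) ℝ}
    (hx : x.IsHomogeneous 1) (hl : ∀ i, (l i).IsHomogeneous 1)
    (h : x - ∑ i, a i * l i ∈ X.vanishingIdeal) :
    x - ∑ i, MvPolynomial.coeff 0 (a i) • l i ∈ X.vanishingIdeal := by
  intro v hv
  have hsmul : ∀ {p : MvPolynomial (Fin (n + 1)) ℝ}, p.IsHomogeneous 1 → ∀ t : ℂ,
      MvPolynomial.aeval (t • v) p = t * MvPolynomial.aeval v p := fun {p} hp t => by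
    rw [← MvPolynomial.mem_homogeneousSubmodule,
      MvPolynomial.homogeneousSubmodule_one_eq_span_X] at hp
    induction hp using Submodule.span_induction with
    | mem p hp =>
      obtain ⟨i, rfl⟩ := hp
      simp
    | zero => simp
    | add p q _ _ hp hq => rw [map_add, map_add, hp, hq, mul_add]
    | smul c p _ hp => rw [map_smul, map_smul, hp, mul_smul_comm]
  -- The cone over X is stable under scaling: evaluating the relation at `t • v` and dividing by t ≠
  -- 0 gives φ(t) = 0. By continuity φ(0) = 0, where only the constant terms of the `a i` survive.
  let φ : ℂ → ℂ := fun t => MvPolynomial.aeval v x -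
    ∑ i, MvPolynomial.aeval (t • v) (a i) * MvPolynomial.aeval v (l i)
  have hφc : Continuous φ := by
    have hc : ∀ p : MvPolynomial (Fin (n + 1)) ℝ,
        Continuous fun t : ℂ => MvPolynomial.aeval (t • v) p := fun p => by
      simp only [MvPolynomial.aeval_def, MvPolynomial.eval₂_eq_eval_map]
      exact (MvPolynomial.continuous_eval _).comp (continuous_id.smul continuous_const)
    exact continuous_const.sub (continuous_finsetSum _ fun i _ => (hc _).mul continuous_const)
  have hφ : ∀ t ≠ 0, φ t = 0 := fun t ht => by
    obtain ⟨hv0, hvX⟩ := hv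
    have hmem : t • v ∈ {v : Fin (n + 1) → ℂ | ∃ hv : v ≠ 0,
        Projectivization.mk ℂ v hv ∈ X.carrier} := by
      refine ⟨smul_ne_zero ht hv0, ?_⟩
      rwa [(Projectivization.mk_eq_mk_iff' ℂ _ _ (smul_ne_zero ht hv0) hv0).2 ⟨t, rfl⟩]
    have h1 := h _ hmem
    simp only [map_sub, map_sum, map_mul, hsmul hx, hsmul (hl _)] at h1
    refine (mul_eq_zero.1 (?_ : t * φ t = 0)).resolve_left ht
    rw [← h1, mul_sub, Finset.mul_sum]
    congr 1
    exact Finset.sum_congr rfl fun i _ => by ring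
  have h0 : φ 0 = 0 := by
    have h1 : Set.EqOn φ (fun _ => 0) {0}ᶜ := hφ
    exact congrFun (hφc.ext_on (dense_compl_singleton 0) continuous_const h1) 0
  simp only [φ, zero_smul] at h0
  rw [map_sub, map_sum, ← h0]
  congr 1
  refine Finset.sum_congr rfl fun i _ => ?_
  rw [map_smul, Algebra.smul_def]
  congr 1
  simp [MvPolynomial.aeval_zero, MvPolynomial.constantCoeff_eq]

/-- The linear forms in the ideal generated by linear forms `l` are the linear combinations
of `l`. -/
theorem mem_span_of_mem_idealOf {l : Fin k → X.forms 1} {x : X.forms 1}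
    (h : (x : X.CoordRing) ∈ idealOf l) : x ∈ Submodule.span ℝ (Set.range l) := by
  obtain ⟨c, hc⟩ := (Ideal.mem_span_range_iff_exists_fun).1 h
  have hsurj : Function.Surjective X.toCoordRing := Ideal.Quotient.mkₐ_surjective ℝ _
  choose a ha using fun i => hsurj (c i)
  obtain ⟨p, hp, hpx⟩ := x.2
  choose q hq hql using fun i => (l i).2
  have hker : ∀ r, X.toCoordRing r = 0 ↔ r ∈ X.vanishingIdeal := fun r =>
    Ideal.Quotient.eq_zero_iff_mem
  have h1 : p - ∑ i, a i * q i ∈ X.vanishingIdeal := by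
    rw [← hker, map_sub, map_sum, sub_eq_zero]
    refine hpx.trans (hc.symm.trans (Finset.sum_congr rfl fun i _ => ?_))
    rw [map_mul, ha]
    exact congrArg _ (hql i).symm
  have h2 := (hker _).2 (sub_sum_coeff_zero_smul_mem_vanishingIdeal hp hq h1)
  rw [map_sub, map_sum, sub_eq_zero] at h2
  have h3 : x = ∑ i, MvPolynomial.coeff 0 (a i) • l i := by
    refine Subtype.ext (hpx.symm.trans (h2.trans ?_))
    rw [Submodule.coe_sum]
    refine Finset.sum_congr rfl fun i _ => ?_
    rw [map_smul, Submodule.coe_smul]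
    exact congrArg _ (hql i)
  rw [h3]
  exact Submodule.sum_mem _ fun i _ => Submodule.smul_mem _ _ (Submodule.subset_span ⟨i, rfl⟩)

/-- Real radicality puts each entry in the ideal, whose linear forms are spanned by l. -/
theorem _root_.IsRealRadical.mem_span_of_sumMul_eq {l : Fin k → X.forms 1}
    (h : IsRealRadical (idealOf l)) (v p : Fin k → X.forms 1)
    (hvp : sumMul X.mulFormsₗ v v = sumMul X.mulFormsₗ l p) (i : Fin k) :
    v i ∈ Submodule.span ℝ (Set.range l) := by
  refine mem_span_of_mem_idealOf (h k (fun i => (v i : X.CoordRing)) ?_ i)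
  have h1 := congrArg Subtype.val hvp
  rw [← sum_mulForms, ← sum_mulForms, Submodule.coe_sum, Submodule.coe_sum] at h1
  have h2 : ∑ i, (v i : X.CoordRing) ^ 2 = ∑ i, (l i : X.CoordRing) * (p i : X.CoordRing) := by
    simp only [sq]
    exact h1
  rw [h2]
  exact Ideal.sum_mem _ fun j _ => Ideal.mul_mem_right _ _ (Ideal.subset_span ⟨j, rfl⟩)

/-! ### Translation to normed spaces -/

section Transfer

/-- A norm on the finite-dimensional space of linear forms. -/
noncomputable abbrev coordNorm : NormedAddCommGroup (X.forms 1) :=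
  NormedAddCommGroup.induced _ (Fin (Module.finrank ℝ (X.forms 1)) → ℝ)
    (Module.finBasis ℝ (X.forms 1)).equivFun (LinearEquiv.injective _)

attribute [local instance] coordNorm

/-- The normed space structure belonging to `coordNorm`. -/
noncomputable abbrev coordNormedSpace : NormedSpace ℝ (X.forms 1) :=
  NormedSpace.induced ℝ _ (Fin (Module.finrank ℝ (X.forms 1)) → ℝ)
    (Module.finBasis ℝ (X.forms 1)).equivFun

attribute [local instance] coordNormedSpace

/-- The choice of auxiliary norm is harmless for local minimality. -/
theorem moduleTopology_forms_one :
    moduleTopology ℝ (X.forms 1) = (inferInstance : TopologicalSpace (X.forms 1)) := by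
  have : IsModuleTopology ℝ (X.forms 1) := isModuleTopologyOfFiniteDimensional
  exact (eq_moduleTopology ℝ (X.forms 1)).symm

variable [ip : InnerProductSpace.Core ℝ (X.forms 2)]

/-- The norm on `R_2` of the fixed inner product. -/
noncomputable abbrev pairingNorm : NormedAddCommGroup (X.forms 2) := ip.toNormedAddCommGroup

attribute [local instance] pairingNorm

/-- The inner product space structure on `R_2` of the fixed inner product. -/
noncomputable abbrev pairingInner : InnerProductSpace ℝ (X.forms 2) :=
  InnerProductSpace.ofCore ip.toCore

attribute [local instance] pairingInner

theorem pairing_eq_inner (g q : X.forms 2) : pairing g q = ⟪g, q⟫ := rfl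

theorem sqDist_eq_norm (f q : X.forms 2) : sqDist f q = ‖q - f‖ ^ 2 :=
  real_inner_self_eq_norm_sq _

theorem objective_eq_norm (f : X.forms 2) (l : Fin k → X.forms 1) :
    objective f l = ‖sumMul X.mulFormsₗ l l - f‖ ^ 2 := by
  rw [objective, sqDist_eq_norm, sumSq_eq_sumMul]

theorem syzygyCondition_iff (l : Fin k → X.forms 1) :
    SyzygyCondition l ↔ ∃ g, IsSyzygyWitness X.mulFormsₗ l g := by
  have horth : ∀ (g : X.forms 2) (h : Fin k → X.forms 1),
      IsOrthTo g (quadPart h) ↔ ∀ p, ⟪g, sumMul X.mulFormsₗ h p⟫ = 0 := fun g h =>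
    ⟨fun H p => H _ ⟨p, (sum_mulForms h p).symm⟩, by
      rintro H _ ⟨p, rfl⟩
      rw [sum_mulForms]
      exact H p⟩
  refine exists_congr fun g => ?_
  simp only [horth, linSyz, Set.mem_ofPred_eq, sum_mulForms, sumSq_eq_sumMul, sosDual,
    sosCone_eq_sumSquares, pairing_eq_inner, not_forall, not_le]
  exact ⟨fun ⟨h1, ⟨q, hq, hneg⟩, h3⟩ =>
      ⟨h1, ⟨q, hq, hneg⟩, fun h hh => (h3 h hh).1, fun h hh => (h3 h hh).2⟩,
    fun ⟨h1, ⟨q, hq, hneg⟩, h3, h4⟩ =>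
      ⟨h1, ⟨q, hq, hneg⟩, fun h hh => ⟨h3 h hh, h4 h hh⟩⟩⟩

theorem isSecondOrderStationary_iff (f : X.forms 2) (l : Fin k → X.forms 1) :
    IsSecondOrderStationary f l ↔ IsSecondOrderCritical X.mulFormsₗ f l := by
  rw [isSecondOrderCritical_iff_deriv X.mulFormsₗ_comm, IsSecondOrderStationary]
  simp only [objective_eq_norm]

theorem not_isConvexMin_iff (f : X.forms 2) (l : Fin k → X.forms 1) :
    ¬ IsConvexMin f l ↔ ∃ q ∈ sumSquares X.mulFormsₗ,
      ‖q - f‖ ^ 2 < ‖sumMul X.mulFormsₗ l l - f‖ ^ 2 := by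
  simp only [IsConvexMin, objective_eq_norm, sqDist_eq_norm, sosCone_eq_sumSquares, not_forall,
    not_le, exists_prop]

theorem isLocalMinimum_iff (f : X.forms 2) (l : Fin k → X.forms 1) :
    IsLocalMinimum f l ↔
      IsLocalMin (fun l' => ‖sumMul X.mulFormsₗ l' l' - f‖ ^ 2) l := by
  rw [IsLocalMinimum, moduleTopology_forms_one]
  simp only [objective_eq_norm]

variable {f : X.forms 2} {l : Fin k → X.forms 1}

theorem IsLocalMinimum.isSecondOrderStationary (h : IsLocalMinimum f l) :
    IsSecondOrderStationary f l := by
  rw [isSecondOrderStationary_iff]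
  exact IsLocalMin.isSecondOrderCritical X.mulFormsₗ_comm ((isLocalMinimum_iff f l).1 h)

theorem IsSecondOrderStationary.syzygyCondition (h : IsSecondOrderStationary f l)
    (hf : ¬ IsConvexMin f l) : SyzygyCondition l :=
  (syzygyCondition_iff l).2 ⟨_, ((isSecondOrderStationary_iff f l).1 h).isSyzygyWitness
    X.mulFormsₗ_comm ((not_isConvexMin_iff f l).1 hf)⟩

theorem SyzygyCondition.exists_isSecondOrderStationary (h : SyzygyCondition l) :
    ∃ f, IsSecondOrderStationary f l ∧ ¬ IsConvexMin f l := by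
  obtain ⟨g, hg⟩ := (syzygyCondition_iff l).1 h
  obtain ⟨ε, hε, hcrit⟩ := hg.exists_isSecondOrderCritical X.mulFormsₗ_comm
  exact ⟨_, (isSecondOrderStationary_iff _ l).2 hcrit,
    (not_isConvexMin_iff _ l).2 (hg.exists_norm_sub_sq_lt hε)⟩

theorem SyzygyCondition.exists_isLocalMinimum (h : SyzygyCondition l)
    (hl : IsRealRadical (idealOf l)) : ∃ f, IsLocalMinimum f l ∧ ¬ IsConvexMin f l := by
  obtain ⟨g, hg⟩ := (syzygyCondition_iff l).1 h
  obtain ⟨ε, hε, hmin⟩ := hg.exists_isLocalMin X.mulFormsₗ_comm hl.mem_span_of_sumMul_eq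
  exact ⟨_, (isLocalMinimum_iff _ l).2 hmin,
    (not_isConvexMin_iff _ l).2 (hg.exists_norm_sub_sq_lt hε)⟩

theorem IsConvexMin.isGlobalMin (h : IsConvexMin f l) : IsGlobalMin f l :=
  fun l' => h _ ⟨k, l', rfl⟩

/-- Here σ_k already reaches the whole cone, so the rank-k and convex problems have the same minimum
value. -/
theorem PythagorasLE.isConvexMin (hk : X.PythagorasLE k) (h : IsGlobalMin f l) :
    IsConvexMin f l := by
  intro q hq
  obtain ⟨a, rfl⟩ := hk q hq
  exact h a

end Transfer

end RealProjectiveVariety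

theorem theorem4 {n : ℕ} (X : RealProjectiveVariety n)
    [InnerProductSpace.Core ℝ (X.forms 2)] {k : ℕ} (l : Fin k → X.forms 1) :
    -- `k` at least the Pythagoras number of `X`: the equivalence of (i), (ii) and, for a real radical
    -- ideal, (iii)
    (X.PythagorasLE k →
      ((∃ f, RealProjectiveVariety.IsSpuriousSOSP f l) ↔
        RealProjectiveVariety.SyzygyCondition l) ∧
      (IsRealRadical (RealProjectiveVariety.idealOf l) →
        ((∃ f, RealProjectiveVariety.IsSpuriousLocalMin f l) ↔
          RealProjectiveVariety.SyzygyCondition l))) ∧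
    -- arbitrary `k`: (iii) implies (i), and (i) implies (ii)
    ((∃ f, RealProjectiveVariety.IsSpuriousLocalMin f l) →
      ∃ f, RealProjectiveVariety.IsSpuriousSOSP f l) ∧
    ((∃ f, RealProjectiveVariety.IsSpuriousSOSP f l) →
      RealProjectiveVariety.SyzygyCondition l) ∧
    -- arbitrary `k`: the equivalences, with spuriousness measured against the minimum over `Σ_X`
    ((∃ f, RealProjectiveVariety.IsSecondOrderStationary f l ∧
        ¬ RealProjectiveVariety.IsConvexMin f l) ↔
      RealProjectiveVariety.SyzygyCondition l) ∧
    (IsRealRadical (RealProjectiveVariety.idealOf l) →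
      ((∃ f, RealProjectiveVariety.IsLocalMinimum f l ∧
          ¬ RealProjectiveVariety.IsConvexMin f l) ↔
        RealProjectiveVariety.SyzygyCondition l)) := by
  refine ⟨fun hk => ⟨⟨?_, ?_⟩, fun hl => ⟨?_, ?_⟩⟩, ?_, ?_, ⟨?_, ?_⟩, fun hl => ⟨?_, ?_⟩⟩
  · rintro ⟨f, h, hf⟩
    exact h.syzygyCondition fun h' => hf h'.isGlobalMin
  · intro h
    obtain ⟨f, h, hf⟩ := h.exists_isSecondOrderStationary
    exact ⟨f, h, fun h' => hf (hk.isConvexMin h')⟩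
  · rintro ⟨f, h, hf⟩
    exact h.isSecondOrderStationary.syzygyCondition fun h' => hf h'.isGlobalMin
  · intro h
    obtain ⟨f, h, hf⟩ := h.exists_isLocalMinimum hl
    exact ⟨f, h, fun h' => hf (hk.isConvexMin h')⟩
  · rintro ⟨f, h, hf⟩
    exact ⟨f, h.isSecondOrderStationary, hf⟩
  · rintro ⟨f, h, hf⟩
    exact h.syzygyCondition fun h' => hf h'.isGlobalMin
  · rintro ⟨f, h, hf⟩
    exact h.syzygyCondition hf
  · exact fun h => h.exists_isSecondOrderStationary
  · rintro ⟨f, h, hf⟩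
    exact h.isSecondOrderStationary.syzygyCondition hf
  · exact fun h => h.exists_isLocalMinimum hl
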